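/- Let $G$ be a finite simple unicyclic graph (a connected graph containing exactly one cycle) on $n$ vertices. For a graph $H$ on $n$ vertices with degree matrix $D(H)$ and adjacency matrix $A(H)$, let $Q(H)=D(H)+A(H)$ be its signless Laplacian matrix, and let the signless Laplacian coefficients $\varphi_0(H),\dots,\varphi_n(H)$ be defined by $$\det\bigl(xI-Q(H)\bigr)=\sum_{i=0}^{n}(-1)^i\varphi_i(H)\,x^{n-i}.$$ Let $uv$ be an edge of $G$ which does not lie on the cycle and is not pendent (neither $u$ nor $v$ has degree $1$). Let $G_{uv}$ be the simple graph on $n$ vertices obtained from $G$ by identifying $u$ and $v$ to a single vertex $w$ (deleting the resulting loop) and adding a new vertex $w'$ joined to $w$ only. Then $$\varphi_i(G)\ \ge\ \varphi_i(G_{uv})\qquad\text{for } i=0,1,\dots,n.$$ If $G$ is not bipartite, equality holds for $i$ if and only if $i\in\{0,1,n\}$; if $G$ is bipartite, equality holds for $i$ if and only if $i\in\{0,1,n-1,n\}$. -/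

import Mathlib

namespace SimpleGraph

variable {V : Type*}

/-- The cycles of `G`, each one given by its set of edges. -/
def cycleEdgeSets (G : SimpleGraph V) : Set (Set (Sym2 V)) :=
  {C | ∃ (v : V) (p : G.Walk v v), p.IsCycle ∧ C = {e | e ∈ p.edges}}

/-- A unicyclic graph: a connected graph which contains exactly one cycle. -/
def IsUnicyclic (G : SimpleGraph V) : Prop :=
  G.Connected ∧ ∃! C : Set (Sym2 V), C ∈ G.cycleEdgeSets

open Classical in
/-- A pendent edge: an edge incident to a vertex of degree one. -/
def IsPendentEdge [Fintype V] (G : SimpleGraph V) (e : Sym2 V) : Prop :=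
  e ∈ G.edgeSet ∧ ∃ x ∈ e, G.degree x = 1

open Classical in
/-- The signless Laplacian matrix `Q(G) = D(G) + A(G)`. -/
noncomputable def signlessLapMatrix [Fintype V] (G : SimpleGraph V) : Matrix V V ℝ :=
  G.degMatrix ℝ + G.adjMatrix ℝ

open Classical in
/-- The signless Laplacian coefficient `φ_i(G)`, for `0 ≤ i ≤ n = |V|`, determined by
`det (x I - Q(G)) = ∑_{i=0}^{n} (-1)^i φ_i(G) x^(n-i)`. -/
noncomputable def signlessLapCoeff [Fintype V] (G : SimpleGraph V) (i : ℕ) : ℝ :=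
  (-1) ^ i * G.signlessLapMatrix.charpoly.coeff (Fintype.card V - i)

open Classical in
/-- The graph `G_{uv}` obtained from `G` by identifying `u` and `v` to a vertex `w` and adding a
new vertex `w'` joined to `w` only. It lives on the vertex set of `G`: the merged vertex `w` keeps
the name `u` (the map sends `v` to `u`; loops and repeated edges disappear), and the name `v`,
which the identification sets free, is given to the new vertex `w'`. -/
noncomputable def contractAttach (G : SimpleGraph V) (u v : V) : SimpleGraph V :=
  G.map (fun x => if x = v then u else x) ⊔ edge u v

end SimpleGraph

/-! Let `H = G - uv`. Since `uv` lies on no cycle it is a bridge, so `Q(H)` is block diagonal with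
`u` and `v` in different blocks. Eliminating all other vertices by a Schur complement leaves 2×2
determinants: with P and R the terms of the two sides, `G` gives (x-1-P)(x-1-R) - 1 and `G_{uv}`
gives (x-1-P-R)(x-1) - 1. They differ by PR, and reading off coefficients shows that φ_i(G) -
φ_i(G_{uv}) is the sum of the principal minors of `Q(H)` of order i whose index set contains `u` and
`v`.

`Q(H)` is positive semidefinite, its quadratic form being the sum of (x_a + x_b)² over the edges, so
all these minors are nonnegative and the inequality follows. Equality means that every such minor
vanishes, that is, every admissible index set supports a nonzero function changing sign along each
edge of `H`. Such a function has constant absolute value on each of the two components of `H`, and a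
component carries a nonzero one exactly when it is bipartite. At least one component is acyclic,
hence bipartite; both are bipartite if and only if `G` is. The equality cases then depend on which
components an index set can fail to contain. -/

/-! ### Determinant identities -/

open scoped Classical in
/-- Expansion of the determinant along two indices by means of the Schur complement. -/
theorem Matrix.det_eq_schur_pair {V : Type*} [Fintype V] (M : Matrix V V ℝ) {u v : V}
    (huv : u ≠ v) (W : Matrix {c : V // c ≠ u ∧ c ≠ v} {c : V // c ≠ u ∧ c ≠ v} ℝ)
    (a b a' b' : {c : V // c ≠ u ∧ c ≠ v} → ℝ)
    (hW : ∀ c d : {c : V // c ≠ u ∧ c ≠ v}, M c d = W c d) (h0 : W.det ≠ 0)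
    (ha : ∀ c : {c : V // c ≠ u ∧ c ≠ v}, M u c = a c)
    (hb : ∀ c : {c : V // c ≠ u ∧ c ≠ v}, M v c = b c)
    (ha' : ∀ c : {c : V // c ≠ u ∧ c ≠ v}, M c u = a' c)
    (hb' : ∀ c : {c : V // c ≠ u ∧ c ≠ v}, M c v = b' c) :
    M.det = W.det *
      ((M u u - a ⬝ᵥ (W⁻¹.mulVec a')) * (M v v - b ⬝ᵥ (W⁻¹.mulVec b')) -
        (M u v - a ⬝ᵥ (W⁻¹.mulVec b')) * (M v u - b ⬝ᵥ (W⁻¹.mulVec a'))) := by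
  have hbij : Function.Bijective
      (Sum.elim ![u, v] (Subtype.val : {c : V // c ≠ u ∧ c ≠ v} → V)) := by
    constructor
    · rintro (i | c) (j | d) h
      · fin_cases i <;> fin_cases j <;> simp_all
      · fin_cases i
        · exact absurd h.symm d.2.1
        · exact absurd h.symm d.2.2
      · fin_cases j
        · exact absurd h c.2.1
        · exact absurd h c.2.2
      · exact congrArg Sum.inr (Subtype.ext h)
    · intro c
      by_cases h1 : c = u
      · exact ⟨.inl 0, h1.symm⟩
      by_cases h2 : c = v
      · exact ⟨.inl 1, h2.symm⟩
      exact ⟨.inr ⟨c, h1, h2⟩, rfl⟩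
  let e := Equiv.ofBijective _ hbij
  rw [← Matrix.det_submatrix_equiv_self e M]
  let P : Matrix (Fin 2) (Fin 2) ℝ := !![M u u, M u v; M v u, M v v]
  let B : Matrix (Fin 2) {c : V // c ≠ u ∧ c ≠ v} ℝ := Matrix.of ![a, b]
  let B' : Matrix {c : V // c ≠ u ∧ c ≠ v} (Fin 2) ℝ := Matrix.of fun c j => ![a', b'] j c
  have hM : M.submatrix e e = Matrix.fromBlocks P B B' W := by
    ext (i | c) (j | d)
    · fin_cases i <;> fin_cases j <;> rfl
    · fin_cases i
      · exact ha d
      · exact hb d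
    · fin_cases j
      · exact ha' c
      · exact hb' c
    · exact hW c d
  have := W.invertibleOfIsUnitDet (isUnit_iff_ne_zero.mpr h0)
  rw [hM, Matrix.det_fromBlocks₂₂, Matrix.det_fin_two, Matrix.invOf_eq_nonsing_inv,
    Matrix.mul_assoc]
  rfl

open scoped Classical in
/-- Determinant of the sum of a diagonal matrix and a matrix in terms of principal minors. -/
theorem Matrix.det_diagonal_add {V R : Type*} [Fintype V] [CommRing R] (d : V → R)
    (K : Matrix V V R) :
    (Matrix.diagonal d + K).det =
      ∑ s : Finset V, (∏ i ∈ sᶜ, d i) * (K.submatrix (↑) (↑) : Matrix s s R).det := by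
  rw [add_comm]
  refine ((Matrix.detRowAlternating (R := R) (n := V)).map_add_univ
    (fun i => K i) (fun i => Matrix.diagonal d i)).trans ?_
  refine Finset.sum_congr rfl fun s _ => ?_
  rw [← Matrix.det_piecewise_one_eq_submatrix_det]
  -- Off `s` the rows are multiples `d i` of unit rows, so the factors `d i` can be pulled out.
  have : s.piecewise (fun i => K i) (fun i => Matrix.diagonal d i) =
      Matrix.of fun i j => (if i ∈ s then 1 else d i) *
        (Matrix.of (s.piecewise K.row (1 : Matrix V V R).row)) i j := by
    ext i j
    by_cases h : i ∈ s
    · simp [Finset.piecewise, h, Matrix.row]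
    · simp [Finset.piecewise, h, Matrix.row, Matrix.diagonal, Matrix.one_apply]
  change Matrix.det _ = _
  rw [this, Matrix.det_mul_column]
  congr 1
  rw [Finset.prod_ite, Finset.prod_const_one, one_mul]
  refine Finset.prod_congr ?_ fun _ _ => rfl
  ext i; simp

/-- If `W` is block diagonal with respect to `p` and the supports of `a` and `b` lie in different
blocks, then the bilinear form of `W⁻¹` vanishes at `(a, b)`. -/
theorem Matrix.dotProduct_inv_mulVec_eq_zero {C R : Type*} [Fintype C] [DecidableEq C]
    [CommRing R] (W : Matrix C C R) (h0 : IsUnit W.det) (p : C → Prop)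
    (hW : ∀ i j, W i j ≠ 0 → (p i ↔ p j)) (a b : C → R) (ha : ∀ i, a i ≠ 0 → p i)
    (hb : ∀ i, b i ≠ 0 → ¬ p i) : a ⬝ᵥ (W⁻¹.mulVec b) = 0 := by
  classical
  set y := W⁻¹.mulVec b with hy
  have hWy : W.mulVec y = b := by
    rw [hy, Matrix.mulVec_mulVec, Matrix.mul_nonsing_inv _ h0, Matrix.one_mulVec]
  -- Truncating the solution `y` of `W y = b` to the block `p` solves the system with right-hand
  -- side zero, because `b` vanishes on that block.
  have hz : (fun i => if p i then y i else 0) = 0 := by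
    have : W.mulVec (fun i => if p i then y i else 0) = 0 := by
      ext i
      by_cases hi : p i
      · have hbi : b i = 0 := by
          by_contra h
          exact hb i h hi
        rw [Pi.zero_apply, ← hbi, ← hWy]
        refine Finset.sum_congr rfl fun j _ => ?_
        by_cases hj : p j
        · simp [hj]
        · have : W i j = 0 := by
            by_contra h
            exact hj ((hW i j h).1 hi)
          simp [this]
      · refine Finset.sum_eq_zero fun j _ => ?_
        by_cases hj : p j
        · have : W i j = 0 := by
            by_contra h
            exact hi ((hW i j h).2 hj)
          simp [this]
        · simp [hj]
    have h2 := congrArg (W⁻¹.mulVec) this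
    rwa [Matrix.mulVec_mulVec, Matrix.nonsing_inv_mul _ h0, Matrix.one_mulVec,
      Matrix.mulVec_zero] at h2
  refine Finset.sum_eq_zero fun i _ => ?_
  by_cases hi : p i
  · have := congrFun hz i
    simp only [hi, if_true, Pi.zero_apply] at this
    rw [this, mul_zero]
  · have : a i = 0 := by
      by_contra h
      exact hi (ha i h)
    rw [this, zero_mul]

open scoped Classical in
/-- Suppose that `K` is block diagonal with respect to `p`, with `u` and `v` in different blocks,
that `Q` is `K` plus the signless Laplacian of the edge `uv`, and that `Q'` arises from `K` by
identifying `u` and `v` and attaching a new vertex to the result. Then the difference of the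
characteristic polynomials of `Q` and `Q'` is given by the principal minors of `K` which contain
both `u` and `v`. -/
theorem Matrix.charpoly_sub_charpoly_of_contract {V : Type*} [Fintype V] {u v : V} (huv : u ≠ v)
    (K Q Q' : Matrix V V ℝ) (p : V → Prop) (hu : p u) (hv : ¬ p v)
    (hK : ∀ i j, K i j ≠ 0 → (p i ↔ p j))
    (hQ : ∀ c, c ≠ u → c ≠ v → ∀ d, Q c d = K c d ∧ Q d c = K d c)
    (hQuu : Q u u = K u u + 1) (hQvv : Q v v = K v v + 1) (hQuv : Q u v = 1) (hQvu : Q v u = 1)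
    (hQ' : ∀ c, c ≠ u → c ≠ v → ∀ d, d ≠ u → d ≠ v → Q' c d = K c d)
    (hQ'u : ∀ c, c ≠ u → c ≠ v → Q' u c = K u c + K v c ∧ Q' c u = K c u + K c v)
    (hQ'v : ∀ c, c ≠ u → c ≠ v → Q' v c = 0 ∧ Q' c v = 0)
    (hQ'uu : Q' u u = K u u + K v v + 1) (hQ'vv : Q' v v = 1) (hQ'uv : Q' u v = 1)
    (hQ'vu : Q' v u = 1) :
    Q.charpoly - Q'.charpoly = ∑ s : Finset V, if u ∈ s ∧ v ∈ s then
      Polynomial.C ((-1) ^ s.card * (K.submatrix (↑) (↑) : Matrix s s ℝ).det) *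
        Polynomial.X ^ (Fintype.card V - s.card) else 0 := by
  let ku : {c : V // c ≠ u ∧ c ≠ v} → ℝ := fun c => K u c
  let kv : {c : V // c ≠ u ∧ c ≠ v} → ℝ := fun c => K v c
  let ku' : {c : V // c ≠ u ∧ c ≠ v} → ℝ := fun c => K c u
  let kv' : {c : V // c ≠ u ∧ c ≠ v} → ℝ := fun c => K c v
  let KC : Matrix {c : V // c ≠ u ∧ c ≠ v} {c : V // c ≠ u ∧ c ≠ v} ℝ := K.submatrix (↑) (↑)
  have hKuv : K u v = 0 := by
    by_contra h
    exact hv ((hK _ _ h).1 hu)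
  have hKvu : K v u = 0 := by
    by_contra h
    exact hv ((hK _ _ h).2 hu)
  -- It suffices to evaluate away from the finitely many eigenvalues of `KC`, where the Schur
  -- complement exists.
  refine Polynomial.eq_of_infinite_eval_eq _ _ (Set.Infinite.mono ?_
    (Polynomial.finite_setOfPred_isRoot KC.charpoly_monic.ne_zero).infinite_compl)
  intro x hx
  let W := Matrix.scalar {c : V // c ≠ u ∧ c ≠ v} x - KC
  have h0 : W.det ≠ 0 := by
    rw [← Matrix.eval_charpoly]
    exact hx
  have hWK : ∀ c d : {c : V // c ≠ u ∧ c ≠ v},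
      W c d = (if (c : V) = d then x else 0) - K c d := by
    intro c d
    by_cases h : c = d
    · simp [W, KC, h]
    · have h' : (c : V) ≠ d := fun h' => h (Subtype.ext h')
      simp [W, KC, h, h']
  have hcross : ∀ (a b : {c : V // c ≠ u ∧ c ≠ v} → ℝ) (q : V → Prop)
      (_ : ∀ i j, K i j ≠ 0 → (q i ↔ q j))
      (_ : ∀ i, a i ≠ 0 → q i) (_ : ∀ i, b i ≠ 0 → ¬ q i), a ⬝ᵥ (W⁻¹.mulVec b) = 0 := by
    intro a b q hq ha hb
    refine Matrix.dotProduct_inv_mulVec_eq_zero W (isUnit_iff_ne_zero.mpr h0) (fun c => q c)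
      (fun i j hij => ?_) a b ha hb
    rw [hWK] at hij
    split_ifs at hij with h
    · rw [h]
    · exact hq _ _ (by simpa using hij)
  have hc1 : ku ⬝ᵥ (W⁻¹.mulVec kv') = 0 :=
    hcross _ _ p hK (fun i hi => (hK _ _ hi).1 hu) (fun i hi h => hv ((hK _ _ hi).1 h))
  have hc2 : kv ⬝ᵥ (W⁻¹.mulVec ku') = 0 :=
    hcross _ _ (fun i => ¬ p i) (fun i j h => not_congr (hK i j h))
      (fun i hi h => hv ((hK _ _ hi).2 h)) (fun i hi h => h ((hK _ _ hi).2 hu))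
  have hne : ∀ c : {c : V // c ≠ u ∧ c ≠ v}, u ≠ c ∧ v ≠ c :=
    fun c => ⟨c.2.1.symm, c.2.2.symm⟩
  have e1 := Matrix.det_eq_schur_pair (Matrix.scalar V x - Q) huv W (-ku) (-kv) (-ku') (-kv')
    (fun c d => by
      rw [hWK, ← (hQ c c.2.1 c.2.2 d).1]
      simp [Matrix.diagonal]) h0
    (fun c => by simp [ku, (hne c).1, (hQ c c.2.1 c.2.2 u).2])
    (fun c => by simp [kv, (hne c).2, (hQ c c.2.1 c.2.2 v).2])
    (fun c => by simp [ku', c.2.1, (hQ c c.2.1 c.2.2 u).1])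
    (fun c => by simp [kv', c.2.2, (hQ c c.2.1 c.2.2 v).1])
  have e2 := Matrix.det_eq_schur_pair (Matrix.scalar V x - Q') huv W (-(ku + kv)) 0
    (-(ku' + kv')) 0
    (fun c d => by
      rw [hWK, ← hQ' c c.2.1 c.2.2 d d.2.1 d.2.2]
      simp [Matrix.diagonal]) h0
    (fun c => by
      simp only [ku, kv, Matrix.sub_apply, Matrix.scalar_apply,
        Matrix.diagonal_apply_ne _ (hne c).1, (hQ'u c c.2.1 c.2.2).1, Pi.neg_apply, Pi.add_apply,
        zero_sub])
    (fun c => by simp [(hne c).2, (hQ'v c c.2.1 c.2.2).1])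
    (fun c => by
      simp only [ku', kv', Matrix.sub_apply, Matrix.scalar_apply,
        Matrix.diagonal_apply_ne _ c.2.1, (hQ'u c c.2.1 c.2.2).2, Pi.neg_apply, Pi.add_apply,
        zero_sub])
    (fun c => by simp [c.2.2, (hQ'v c c.2.1 c.2.2).2])
  -- Removing `x` from the diagonal at `u` and `v` makes the 2×2 determinant equal to PR, the
  -- difference of the other two.
  have e3 := Matrix.det_eq_schur_pair
    (Matrix.diagonal (fun i => if i = u ∨ i = v then 0 else x) + -K) huv W
    (-ku) (-kv) (-ku') (-kv')
    (fun c d => by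
      rw [hWK]
      simp [Matrix.diagonal, c.2.1, c.2.2, sub_eq_add_neg]) h0
    (fun c => by simp [ku, (hne c).1]) (fun c => by simp [kv, (hne c).2])
    (fun c => by simp [ku', c.2.1]) (fun c => by simp [kv', c.2.2])
  simp only [Matrix.mulVec_neg, dotProduct_neg, neg_dotProduct, neg_neg, Matrix.mulVec_add,
    dotProduct_add, add_dotProduct, Matrix.mulVec_zero, dotProduct_zero, zero_dotProduct, hc1, hc2,
    Matrix.sub_apply, Matrix.add_apply, Matrix.neg_apply, Matrix.scalar_apply,
    Matrix.diagonal_apply_eq, Matrix.diagonal_apply_ne _ huv, Matrix.diagonal_apply_ne _ huv.symm,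
    hQuu, hQvv, hQuv, hQvu, hQ'uu, hQ'vv, hQ'uv, hQ'vu, hKuv, hKvu, true_or, or_true, if_true]
    at e1 e2 e3
  change Polynomial.eval x _ = Polynomial.eval x _
  rw [Polynomial.eval_sub, Matrix.eval_charpoly, Matrix.eval_charpoly]
  trans (Matrix.diagonal (fun i => if i = u ∨ i = v then 0 else x) + -K).det
  · simp only [Matrix.scalar_apply]
    rw [e1, e2, e3]
    ring
  · rw [Matrix.det_diagonal_add, Polynomial.eval_finsetSum]
    refine Finset.sum_congr rfl fun s _ => ?_
    split_ifs with h
    · have hneg : ((-K).submatrix (↑) (↑) : Matrix s s ℝ) = -K.submatrix (↑) (↑) := rfl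
      rw [hneg, Matrix.det_neg, Fintype.card_coe, Finset.prod_congr rfl (g := fun _ => x)]
      · rw [Finset.prod_const, Finset.card_compl]
        simp only [Polynomial.eval_mul, Polynomial.eval_C, Polynomial.eval_pow, Polynomial.eval_X]
        ring
      · intro i hi
        rw [Finset.mem_compl] at hi
        rw [if_neg]
        rintro (rfl | rfl)
        · exact hi h.1
        · exact hi h.2
    · rw [Polynomial.eval_zero]
      -- The zero diagonal entries at `u` and `v` kill every term whose index set misses one of
      -- them.
      have : u ∈ sᶜ ∨ v ∈ sᶜ := by
        simp only [Finset.mem_compl]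
        tauto
      rcases this with h | h
      · rw [Finset.prod_eq_zero h (by simp), zero_mul]
      · rw [Finset.prod_eq_zero h (by simp), zero_mul]

/-! ### Alternating functions and the signless Laplacian form -/

namespace SimpleGraph

/-- Functions on the vertices which change sign along every edge: the kernel of the signless
Laplacian matrix. -/
def IsSignAlternating {V : Type*} (G : SimpleGraph V) (x : V → ℝ) : Prop :=
  ∀ a b, G.Adj a b → x a = -x b

/-- The absolute value of an alternating function is constant along walks. -/
theorem IsSignAlternating.eq_zero_of_reachable {V : Type*} {G : SimpleGraph V} {x : V → ℝ}
    (hx : G.IsSignAlternating x) {a b : V} (hab : G.Reachable a b) (ha : x a = 0) : x b = 0 := by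
  rw [reachable_iff_reflTransGen] at hab
  induction hab with
  | refl => exact ha
  | tail _ h ih => simpa [ih] using hx _ _ h

open scoped Classical in
theorem IsSignAlternating.restrict {V : Type*} {G : SimpleGraph V} {x : V → ℝ}
    (hx : G.IsSignAlternating x) {p : V → Prop} (hp : ∀ a b, G.Adj a b → (p a ↔ p b)) :
    G.IsSignAlternating fun a => if p a then x a else 0 := by
  intro a b hab
  by_cases ha : p a
  · simp [ha, (hp a b hab).1 ha, hx a b hab]
  · simp [ha, mt (hp a b hab).2 ha]

/-- A 2-colouring gives values ±1; conversely the sign of a nowhere zero alternating function is a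
2-colouring. -/
theorem isBipartite_iff_exists_isSignAlternating {V : Type*} {G : SimpleGraph V} :
    G.IsBipartite ↔ ∃ x : V → ℝ, G.IsSignAlternating x ∧ ∀ a, x a ≠ 0 := by
  classical
  constructor
  · rintro ⟨c⟩
    refine ⟨fun a => if c a = 0 then 1 else -1, fun a b hab => ?_, fun a => ?_⟩
    · have := c.valid hab
      by_cases h1 : c a = 0 <;> by_cases h2 : c b = 0
      · exact absurd (h1.trans h2.symm) this
      · simp [h1, h2]
      · simp [h1, h2]
      · exact absurd (by omega) this
    · dsimp only
      split_ifs <;> norm_num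
  · rintro ⟨x, hx, h0⟩
    refine ⟨Coloring.mk (fun a => if 0 < x a then (0 : Fin 2) else 1) ?_⟩
    intro a b hab
    have h := hx a b hab
    rcases lt_or_gt_of_ne (h0 b) with hb | hb
    · have ha : 0 < x a := by linarith
      simp [ha, hb.not_gt]
    · have ha : ¬ 0 < x a := by linarith
      simp [ha, hb]

open scoped Classical in
theorem signlessLapMatrix_apply {V : Type*} [Fintype V] (G : SimpleGraph V) (i j : V) :
    G.signlessLapMatrix i j =
      (if i = j then ∑ k, if G.Adj i k then (1 : ℝ) else 0 else 0) +
        if G.Adj i j then 1 else 0 := by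
  simp only [signlessLapMatrix, degMatrix, Matrix.add_apply, Matrix.diagonal_apply,
    adjMatrix_apply, Finset.sum_boole, degree, neighborFinset_eq_filter]

open scoped Classical in
theorem signlessLapMatrix_mulVec {V : Type*} [Fintype V] (G : SimpleGraph V) (x : V → ℝ) (i : V) :
    G.signlessLapMatrix.mulVec x i = ∑ j, if G.Adj i j then x i + x j else 0 := by
  simp only [Matrix.mulVec, dotProduct, signlessLapMatrix_apply, add_mul, ite_mul, zero_mul,
    one_mul, Finset.sum_add_distrib, Finset.sum_ite_eq, Finset.mem_univ, if_true, Finset.sum_mul]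
  rw [← Finset.sum_add_distrib]
  refine Finset.sum_congr rfl fun j _ => ?_
  split_ifs <;> simp

-- The sum runs over ordered pairs, so each edge is counted twice. The formula averages two
-- expressions of the form which differ by swapping `i` and `j`.
open scoped Classical in
theorem dotProduct_signlessLapMatrix_mulVec {V : Type*} [Fintype V] (G : SimpleGraph V)
    (x : V → ℝ) : x ⬝ᵥ G.signlessLapMatrix.mulVec x =
      (∑ i, ∑ j, if G.Adj i j then (x i + x j) ^ 2 else 0) / 2 := by
  have h1 : x ⬝ᵥ G.signlessLapMatrix.mulVec x =
      ∑ i, ∑ j, if G.Adj i j then x i * (x i + x j) else 0 := by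
    simp only [dotProduct, signlessLapMatrix_mulVec, Finset.mul_sum, mul_ite, mul_zero]
  have h2 : x ⬝ᵥ G.signlessLapMatrix.mulVec x =
      ∑ i, ∑ j, if G.Adj i j then x j * (x i + x j) else 0 := by
    rw [h1, Finset.sum_comm]
    refine Finset.sum_congr rfl fun i _ => Finset.sum_congr rfl fun j _ => ?_
    rw [G.adj_comm, add_comm (x j)]
  rw [eq_div_iff two_ne_zero, mul_two]
  nth_rw 1 [h1]
  rw [h2, ← Finset.sum_add_distrib]
  refine Finset.sum_congr rfl fun i _ => ?_
  rw [← Finset.sum_add_distrib]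
  refine Finset.sum_congr rfl fun j _ => ?_
  split_ifs <;> ring

theorem dotProduct_signlessLapMatrix_mulVec_eq_zero_iff {V : Type*} [Fintype V]
    (G : SimpleGraph V) (x : V → ℝ) :
    x ⬝ᵥ G.signlessLapMatrix.mulVec x = 0 ↔ G.IsSignAlternating x := by
  classical
  have h0 : ∀ i j, (0 : ℝ) ≤ if G.Adj i j then (x i + x j) ^ 2 else 0 := by
    intro i j
    split_ifs
    · positivity
    · exact le_rfl
  rw [dotProduct_signlessLapMatrix_mulVec, div_eq_zero_iff, or_iff_left two_ne_zero,
    Finset.sum_eq_zero_iff_of_nonneg fun i _ => Finset.sum_nonneg fun j _ => h0 i j]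
  simp only [Finset.sum_eq_zero_iff_of_nonneg fun j _ => h0 _ j, Finset.mem_univ, true_imp_iff]
  refine forall_congr' fun i => forall_congr' fun j => ?_
  rw [ite_eq_right_iff]
  refine imp_congr_right fun _ => ?_
  rw [sq_eq_zero_iff, add_eq_zero_iff_eq_neg]

theorem posSemidef_signlessLapMatrix {V : Type*} [Fintype V] (G : SimpleGraph V) :
    G.signlessLapMatrix.PosSemidef := by
  classical
  refine .of_dotProduct_mulVec_nonneg ?_ fun x => ?_
  · ext i j
    rw [Matrix.conjTranspose_apply, star_trivial, signlessLapMatrix_apply, signlessLapMatrix_apply]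
    by_cases h : i = j
    · rw [h]
    · simp [h, Ne.symm h, G.adj_comm]
  · rw [star_trivial, dotProduct_signlessLapMatrix_mulVec]
    refine div_nonneg (Finset.sum_nonneg fun i _ => Finset.sum_nonneg fun j _ => ?_) two_pos.le
    split_ifs
    · positivity
    · exact le_rfl

open scoped Classical in
theorem det_signlessLapMatrix_submatrix_nonneg {V : Type*} [Fintype V] (G : SimpleGraph V)
    (s : Finset V) : 0 ≤ (G.signlessLapMatrix.submatrix (↑) (↑) : Matrix s s ℝ).det :=
  (G.posSemidef_signlessLapMatrix.submatrix _).det_nonneg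

open scoped Classical in
/-- A principal minor of the signless Laplacian matrix vanishes if and only if some nonzero
alternating function is supported on the corresponding vertices. -/
theorem det_signlessLapMatrix_submatrix_eq_zero_iff {V : Type*} [Fintype V] (G : SimpleGraph V)
    (s : Finset V) : (G.signlessLapMatrix.submatrix (↑) (↑) : Matrix s s ℝ).det = 0 ↔
      ∃ x : V → ℝ, x ≠ 0 ∧ G.IsSignAlternating x ∧ ∀ c ∉ s, x c = 0 := by
  rw [← Matrix.exists_mulVec_eq_zero_iff]
  have key : ∀ x : V → ℝ, (∀ c ∉ s, x c = 0) → ∀ i : s,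
      (G.signlessLapMatrix.submatrix (↑) (↑) : Matrix s s ℝ).mulVec (fun c => x c) i =
        G.signlessLapMatrix.mulVec x i := by
    intro x hx i
    simp only [Matrix.mulVec, dotProduct, Matrix.submatrix_apply]
    rw [Finset.sum_coe_sort s (fun c => G.signlessLapMatrix i c * x c)]
    exact Finset.sum_subset (Finset.subset_univ s) fun c _ hc => by rw [hx c hc, mul_zero]
  constructor
  · rintro ⟨y, hy, hQy⟩
    let x : V → ℝ := fun c => if h : c ∈ s then y ⟨c, h⟩ else 0
    have hxs : ∀ c ∉ s, x c = 0 := fun c hc => by simp [x, hc]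
    have hxy : (fun c : s => x c) = y := by
      ext c
      simp [x]
    refine ⟨x, fun h => hy ?_, ?_, hxs⟩
    · rw [← hxy, h]
      rfl
    -- The hypothesis gives `Q x = 0` only on `s`, but `x` vanishes elsewhere, so the quadratic form
    -- at `x` is zero, which is enough.
    · rw [← dotProduct_signlessLapMatrix_mulVec_eq_zero_iff]
      refine Finset.sum_eq_zero fun c _ => ?_
      by_cases hc : c ∈ s
      · rw [← key x hxs ⟨c, hc⟩, hxy, hQy, Pi.zero_apply, mul_zero]
      · rw [hxs c hc, zero_mul]
  · rintro ⟨x, hx0, hx, hxs⟩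
    refine ⟨fun c => x c, fun h => hx0 ?_, ?_⟩
    · ext c
      by_cases hc : c ∈ s
      · exact congrFun h ⟨c, hc⟩
      · exact hxs c hc
    · ext i
      rw [key x hxs, signlessLapMatrix_mulVec]
      refine Finset.sum_eq_zero fun j _ => ?_
      split_ifs with h
      · rw [hx _ _ h, neg_add_cancel]
      · rfl

/-! ### Coefficients under contraction of a bridge -/

open scoped Classical in
theorem contractAttach_adj {V : Type*} (G : SimpleGraph V) (u v : V) (i j : V) :
    (G.contractAttach u v).Adj i j ↔ i ≠ j ∧
      ((∃ a b, G.Adj a b ∧ (if a = v then u else a) = i ∧ (if b = v then u else b) = j) ∨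
        (i = u ∧ j = v ∨ i = v ∧ j = u)) := by
  simp only [contractAttach, sup_adj, map_adj', edge_adj]
  constructor
  · rintro (⟨h, a, b, hab, h1, h2⟩ | ⟨h, h'⟩)
    · exact ⟨h, Or.inl ⟨a, b, hab, by convert h1, by convert h2⟩⟩
    · exact ⟨h', Or.inr (by tauto)⟩
  · rintro ⟨h, ⟨a, b, hab, h1, h2⟩ | h'⟩
    · exact Or.inl ⟨h, a, b, hab, by convert h1, by convert h2⟩
    · exact Or.inr ⟨by tauto, h⟩

open scoped Classical in
/-- For an edge `uv` which is a bridge, the difference of the signless Laplacian coefficients of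
`G` and `G_{uv}` is a sum of principal minors of the signless Laplacian matrix of `G - uv`. -/
theorem signlessLapCoeff_sub_signlessLapCoeff_contractAttach {V : Type*} [Fintype V]
    (G : SimpleGraph V) {u v : V} (huv : G.Adj u v) (hb : G.IsBridge s(u, v)) {i : ℕ}
    (hi : i ≤ Fintype.card V) :
    G.signlessLapCoeff i - (G.contractAttach u v).signlessLapCoeff i =
      ∑ s ∈ (Finset.univ.powersetCard i : Finset (Finset V)) with u ∈ s ∧ v ∈ s,
        ((G.deleteEdges {s(u, v)}).signlessLapMatrix.submatrix (↑) (↑) : Matrix s s ℝ).det := by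
  rw [isBridge_iff] at hb
  obtain ⟨H, hH⟩ : ∃ H, H = G.deleteEdges {s(u, v)} := ⟨_, rfl⟩
  rw [← hH] at hb ⊢
  have hne : u ≠ v := huv.ne
  have hne' : v ≠ u := hne.symm
  have hadj : ∀ a b, H.Adj a b ↔ G.Adj a b ∧ ¬ (a = u ∧ b = v ∨ a = v ∧ b = u) := by
    intro a b
    simp [hH, deleteEdges_adj]
  have hp : ∀ a b, H.Adj a b → (H.Reachable u a ↔ H.Reachable u b) := fun a b hab =>
    ⟨fun h => h.trans hab.reachable, fun h => h.trans hab.symm.reachable⟩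
  have hHuv : ¬ H.Adj u v := fun h => hb h.reachable
  have hHvu : ¬ H.Adj v u := fun h => hHuv h.symm
  -- A bridge has no common neighbour of its ends, so identifying them merges no edges and degrees
  -- simply add.
  have hex : ∀ c, ¬ (H.Adj u c ∧ H.Adj v c) := fun c h =>
    hb (h.1.reachable.trans h.2.symm.reachable)
  have hG' : ∀ c, c ≠ u → c ≠ v → ∀ d, (G.Adj c d ↔ H.Adj c d) := by
    intro c hcu hcv d
    simp [hadj, hcu, hcv]
  have hGu : ∀ c, G.Adj u c ↔ H.Adj u c ∨ c = v := by
    intro c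
    rw [hadj]
    constructor
    · intro h
      by_cases hc : c = v
      · exact Or.inr hc
      · exact Or.inl ⟨h, by simp [hc, hne]⟩
    · rintro (h | rfl)
      · exact h.1
      · exact huv
  have hGv : ∀ c, G.Adj v c ↔ H.Adj v c ∨ c = u := by
    intro c
    rw [hadj]
    constructor
    · intro h
      by_cases hc : c = u
      · exact Or.inr hc
      · exact Or.inl ⟨h, by simp [hc, hne']⟩
    · rintro (h | rfl)
      · exact h.1
      · exact huv.symm
  have cadj : ∀ c, c ≠ u → c ≠ v → ∀ d, d ≠ u → d ≠ v →
      ((G.contractAttach u v).Adj c d ↔ H.Adj c d) := by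
    intro c hcu hcv d hdu hdv
    rw [contractAttach_adj]
    constructor
    · rintro ⟨-, ⟨a, b, hab, h1, h2⟩ | h⟩
      · split_ifs at h1 h2 <;> grind
      · grind
    · intro h
      exact ⟨h.ne, Or.inl ⟨c, d, ((hadj _ _).1 h).1, by simp [hcv], by simp [hdv]⟩⟩
  have cadj_u : ∀ c, c ≠ u → c ≠ v →
      ((G.contractAttach u v).Adj u c ↔ H.Adj u c ∨ H.Adj v c) := by
    intro c hcu hcv
    rw [contractAttach_adj]
    constructor
    · rintro ⟨-, ⟨a, b, hab, h1, h2⟩ | h⟩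
      · split_ifs at h1 h2 <;> grind
      · grind
    · rintro (h | h)
      · exact ⟨h.ne, Or.inl ⟨u, c, ((hadj _ _).1 h).1, by simp, by simp [hcv]⟩⟩
      · exact ⟨hcu.symm, Or.inl ⟨v, c, ((hadj _ _).1 h).1, by simp, by simp [hcv]⟩⟩
  have cadj_v : ∀ c, ((G.contractAttach u v).Adj v c ↔ c = u) := by
    intro c
    rw [contractAttach_adj]
    constructor
    · rintro ⟨-, ⟨a, b, hab, h1, h2⟩ | h⟩
      · split_ifs at h1 h2 <;> grind
      · grind
    · rintro rfl
      exact ⟨hne', by simp⟩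
  have degGu : (∑ k, if G.Adj u k then (1 : ℝ) else 0) =
      (∑ k, if H.Adj u k then (1 : ℝ) else 0) + 1 := by
    have : ∀ k, (if G.Adj u k then (1 : ℝ) else 0) =
        (if H.Adj u k then (1 : ℝ) else 0) + if k = v then 1 else 0 := by
      intro k
      by_cases hk : k = v <;> simp [hGu, hk, hHuv]
    simp [this, Finset.sum_add_distrib, -Finset.sum_boole]
  have degGv : (∑ k, if G.Adj v k then (1 : ℝ) else 0) =
      (∑ k, if H.Adj v k then (1 : ℝ) else 0) + 1 := by
    have : ∀ k, (if G.Adj v k then (1 : ℝ) else 0) =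
        (if H.Adj v k then (1 : ℝ) else 0) + if k = u then 1 else 0 := by
      intro k
      by_cases hk : k = u <;> simp [hGv, hk, hHvu]
    simp [this, Finset.sum_add_distrib, -Finset.sum_boole]
  have degC : ∀ c, c ≠ u → c ≠ v →
      (∑ k, if (G.contractAttach u v).Adj c k then (1 : ℝ) else 0) =
        ∑ k, if H.Adj c k then (1 : ℝ) else 0 := by
    intro c hcu hcv
    -- An edge from `c` to `v` is moved to `u`, so the two corrections cancel in the degree.
    have : ∀ k, (if (G.contractAttach u v).Adj c k then (1 : ℝ) else 0) =
        (if H.Adj c k then (1 : ℝ) else 0) + (if k = u then if H.Adj c v then 1 else 0 else 0) -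
          if k = v then if H.Adj c v then 1 else 0 else 0 := by
      intro k
      by_cases hku : k = u
      · subst hku
        simp only [(G.contractAttach k v).adj_comm c k, cadj_u c hcu hcv, H.adj_comm c, hne]
        by_cases h1 : H.Adj k c
        · have h2 : ¬ H.Adj v c := fun h2 => hex c ⟨h1, h2⟩
          simp [h1, h2]
        · simp [h1]
      · by_cases hkv : k = v
        · subst hkv
          simp [(G.contractAttach u k).adj_comm c k, cadj_v, hcu, hne']
        · simp [cadj c hcu hcv k hku hkv, hku, hkv]
    simp [this, Finset.sum_add_distrib, Finset.sum_sub_distrib, -Finset.sum_boole]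
  have degCu : (∑ k, if (G.contractAttach u v).Adj u k then (1 : ℝ) else 0) =
      (∑ k, if H.Adj u k then (1 : ℝ) else 0) + (∑ k, if H.Adj v k then (1 : ℝ) else 0) + 1 := by
    have : ∀ k, (if (G.contractAttach u v).Adj u k then (1 : ℝ) else 0) =
        (if H.Adj u k then (1 : ℝ) else 0) + (if H.Adj v k then (1 : ℝ) else 0) +
          if k = v then 1 else 0 := by
      intro k
      by_cases hku : k = u
      · simp [hku, hHvu, hne]
      · by_cases hkv : k = v
        · subst hkv
          simp [(G.contractAttach u k).adj_comm u k, cadj_v, hHuv]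
        · simp only [cadj_u k hku hkv, hkv]
          by_cases h1 : H.Adj u k
          · have h2 : ¬ H.Adj v k := fun h2 => hex k ⟨h1, h2⟩
            simp [h1, h2]
          · simp [h1]
    simp [this, Finset.sum_add_distrib, -Finset.sum_boole]
  have degCv : (∑ k, if (G.contractAttach u v).Adj v k then (1 : ℝ) else 0) = 1 := by
    simp [cadj_v]
  have symm : ∀ (F : SimpleGraph V) (a b : V),
      F.signlessLapMatrix a b = F.signlessLapMatrix b a := by
    intro F a b
    rw [signlessLapMatrix_apply, signlessLapMatrix_apply]
    by_cases h : a = b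
    · rw [h]
    · simp [h, Ne.symm h, F.adj_comm]
  have hQ : ∀ c, c ≠ u → c ≠ v → ∀ d, G.signlessLapMatrix c d = H.signlessLapMatrix c d := by
    intro c hcu hcv d
    simp only [signlessLapMatrix_apply, hG' c hcu hcv]
  have hQu : ∀ c, c ≠ u → c ≠ v → (G.contractAttach u v).signlessLapMatrix u c =
      H.signlessLapMatrix u c + H.signlessLapMatrix v c := by
    intro c hcu hcv
    simp only [signlessLapMatrix_apply, cadj_u c hcu hcv, hcu.symm, hcv.symm, if_false, zero_add]
    by_cases h1 : H.Adj u c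
    · have h2 : ¬ H.Adj v c := fun h2 => hex c ⟨h1, h2⟩
      simp [h1, h2]
    · simp [h1]
  have hQv : ∀ c, c ≠ u → c ≠ v → (G.contractAttach u v).signlessLapMatrix v c = 0 := by
    intro c hcu hcv
    simp [signlessLapMatrix_apply, cadj_v, hcu, hcv.symm]
  have hcp := Matrix.charpoly_sub_charpoly_of_contract hne H.signlessLapMatrix G.signlessLapMatrix
    (G.contractAttach u v).signlessLapMatrix (H.Reachable u) (Reachable.refl u) hb
    (by
      intro a b hab
      rw [signlessLapMatrix_apply] at hab
      by_cases h : a = b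
      · rw [h]
      · refine hp a b ?_
        by_contra h'
        exact hab (by simp [h, h']))
    (fun c hcu hcv d => ⟨hQ c hcu hcv d, by rw [symm G, symm H, hQ c hcu hcv]⟩)
    (by simp only [signlessLapMatrix_apply, degGu, if_true, G.irrefl, H.irrefl, if_false, add_zero])
    (by simp only [signlessLapMatrix_apply, degGv, if_true, G.irrefl, H.irrefl, if_false, add_zero])
    (by simp [signlessLapMatrix_apply, hne, huv])
    (by simp [signlessLapMatrix_apply, hne', huv.symm])
    (fun c hcu hcv d hdu hdv => by
      simp only [signlessLapMatrix_apply, degC c hcu hcv, cadj c hcu hcv d hdu hdv])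
    (fun c hcu hcv => ⟨hQu c hcu hcv, by rw [symm _ c u, hQu c hcu hcv, symm H u, symm H v]⟩)
    (fun c hcu hcv => ⟨hQv c hcu hcv, by rw [symm _ c v, hQv c hcu hcv]⟩)
    (by simp only [signlessLapMatrix_apply, degCu, if_true, H.irrefl,
      (G.contractAttach u v).irrefl, if_false, add_zero])
    (by simp only [signlessLapMatrix_apply, degCv, if_true,
      (G.contractAttach u v).irrefl, if_false, add_zero])
    (by rw [symm]; simp [signlessLapMatrix_apply, hne', cadj_v])
    (by simp [signlessLapMatrix_apply, hne', cadj_v])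
  have hco := congrArg (fun q : Polynomial ℝ => (-1) ^ i * q.coeff (Fintype.card V - i)) hcp
  simp only [Polynomial.coeff_sub, mul_sub, Polynomial.finsetSum_coeff] at hco
  refine hco.trans ?_
  rw [Finset.mul_sum, Finset.sum_filter, ← Finset.sum_subset (Finset.subset_univ
    (Finset.univ.powersetCard i : Finset (Finset V)))]
  · refine Finset.sum_congr rfl fun s hs => ?_
    rw [Finset.mem_powersetCard] at hs
    split_ifs
    · rw [Polynomial.coeff_C_mul_X_pow, hs.2, if_pos rfl, ← mul_assoc, ← mul_pow]
      simp
    · simp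
  · intro s _ hs
    have hs' : s.card ≠ i := fun h => hs (Finset.mem_powersetCard.2 ⟨Finset.subset_univ s, h⟩)
    have hle : s.card ≤ Fintype.card V := Finset.card_le_univ s
    split_ifs
    · rw [Polynomial.coeff_C_mul_X_pow, if_neg (by omega), mul_zero]
    · simp

/-! ### The two sides of the removed edge -/

/-- In a graph with exactly one cycle, the vertices of one of any two complementary sets carry no
cycle. -/
theorem IsUnicyclic.isAcyclic_induce_or {V : Type*} {G : SimpleGraph V} (hG : G.IsUnicyclic)
    (s : Set V) : (G.induce s).IsAcyclic ∨ (G.induce sᶜ).IsAcyclic := by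
  have key : ∀ t : Set V, ¬ (G.induce t).IsAcyclic →
      ∃ C ∈ G.cycleEdgeSets, C.Nonempty ∧ ∀ e ∈ C, ∀ a ∈ e, a ∈ t := by
    intro t ht
    simp only [IsAcyclic, not_forall, not_not] at ht
    obtain ⟨a, p, hp⟩ := ht
    let f : G.induce t →g G := (Embedding.induce t).toHom
    have hf : Function.Injective f := Subtype.val_injective
    refine ⟨{e | e ∈ (p.map f).edges}, ⟨_, p.map f, hp.map hf, rfl⟩, ?_, ?_⟩
    · have hpos : (p.map f).edges ≠ [] := by
        intro h
        have h3 := (hp.map hf).three_le_length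
        rw [← Walk.length_edges, h] at h3
        simp at h3
      exact List.exists_mem_of_ne_nil _ hpos
    · intro e he b hbe
      rw [Set.mem_ofPred_eq, Walk.edges_map, List.mem_map] at he
      obtain ⟨e', -, rfl⟩ := he
      rw [Sym2.mem_map] at hbe
      obtain ⟨c, -, rfl⟩ := hbe
      exact c.2
  by_contra! h
  obtain ⟨C, hC, ⟨e, he⟩, hCs⟩ := key s h.1
  obtain ⟨D, hD, -, hDs⟩ := key sᶜ h.2
  obtain rfl := hG.2.unique hC hD
  induction e with
  | h a b => exact hDs _ he a (Sym2.mem_mk_left a b) (hCs _ he a (Sym2.mem_mk_left a b))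

-- Forests are bipartite, and extension by zero stays alternating because no edge leaves `s`.
open scoped Classical in
theorem IsSignAlternating.exists_of_isAcyclic_induce {V : Type*} {G : SimpleGraph V} {s : Set V}
    (hs : ∀ a b, G.Adj a b → (a ∈ s ↔ b ∈ s)) (h : (G.induce s).IsAcyclic) :
    ∃ x : V → ℝ, G.IsSignAlternating x ∧ ∀ a ∈ s, x a ≠ 0 := by
  obtain ⟨y, hy, hy0⟩ := isBipartite_iff_exists_isSignAlternating.1 h.isBipartite
  refine ⟨fun a => if h : a ∈ s then y ⟨a, h⟩ else 0, fun a b hab => ?_, fun a ha => ?_⟩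
  · by_cases ha : a ∈ s
    · have hb := (hs a b hab).1 ha
      simp only [ha, hb, dif_pos]
      exact hy ⟨a, ha⟩ ⟨b, hb⟩ hab
    · simp [ha, mt (hs a b hab).2 ha]
  · simpa [ha] using hy0 ⟨a, ha⟩

/-- Whenever a walk from `u` crosses the deleted edge, it can be restarted at the endpoint just
reached. -/
theorem reachable_deleteEdges_or {V : Type*} {G : SimpleGraph V} {u : V} (v : V) {c : V}
    (h : G.Reachable u c) :
    (G.deleteEdges {s(u, v)}).Reachable u c ∨ (G.deleteEdges {s(u, v)}).Reachable v c := by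
  rw [reachable_iff_reflTransGen] at h
  induction h with
  | refl => exact Or.inl (Reachable.refl u)
  | @tail b c _ hbc ih =>
    by_cases he : s(b, c) = s(u, v)
    · rcases Sym2.eq_iff.1 he with ⟨-, rfl⟩ | ⟨-, rfl⟩
      · exact Or.inr (Reachable.refl _)
      · exact Or.inl (Reachable.refl _)
    · have : (G.deleteEdges {s(u, v)}).Adj b c := by
        rw [deleteEdges_adj]
        exact ⟨hbc, he⟩
      exact ih.imp (fun h => h.trans this.reachable) fun h => h.trans this.reachable

open scoped Classical in
theorem exists_adj_deleteEdges {V : Type*} [Fintype V] {G : SimpleGraph V} {u v : V}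
    (huv : G.Adj u v) (hd : G.degree u ≠ 1) : ∃ c, (G.deleteEdges {s(u, v)}).Adj u c := by
  by_contra! h
  refine hd ((degree_eq_one_iff_existsUnique_adj).2 ⟨v, huv, fun c hc => ?_⟩)
  by_contra hcv
  refine h c ?_
  rw [deleteEdges_adj]
  refine ⟨hc, fun he => ?_⟩
  rcases Sym2.eq_iff.1 he with ⟨-, h⟩ | ⟨h, -⟩
  · exact hcv h
  · exact huv.ne h

end SimpleGraph

/-! ### The inequality and its equality cases -/

theorem theorem2p2 {V : Type*} [Fintype V] (G : SimpleGraph V) (hG : G.IsUnicyclic)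
    (u v : V) (huv : G.Adj u v) (hpend : ¬ G.IsPendentEdge s(u, v))
    (hcyc : ∀ C ∈ G.cycleEdgeSets, s(u, v) ∉ C) :
    ∀ i : ℕ, i ≤ Fintype.card V →
      (G.contractAttach u v).signlessLapCoeff i ≤ G.signlessLapCoeff i ∧
      (¬ G.IsBipartite →
        (G.signlessLapCoeff i = (G.contractAttach u v).signlessLapCoeff i ↔
          i = 0 ∨ i = 1 ∨ i = Fintype.card V)) ∧
      (G.IsBipartite →
        (G.signlessLapCoeff i = (G.contractAttach u v).signlessLapCoeff i ↔
          i = 0 ∨ i = 1 ∨ i = Fintype.card V - 1 ∨ i = Fintype.card V)) := by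
  classical
  intro i hi
  have hb : G.IsBridge s(u, v) := by
    rw [SimpleGraph.isBridge_iff_forall_cycle_notMem huv]
    exact fun w p hp => hcyc _ ⟨w, p, hp, rfl⟩
  have hdiff := G.signlessLapCoeff_sub_signlessLapCoeff_contractAttach huv hb hi
  have hnonneg := (G.deleteEdges {s(u, v)}).det_signlessLapMatrix_submatrix_nonneg
  have hdet := (G.deleteEdges {s(u, v)}).det_signlessLapMatrix_submatrix_eq_zero_iff
  rw [SimpleGraph.isBridge_iff] at hb
  -- As `uv` is not pendent, both sides contain a further vertex, `c` next to `u` and `d` next to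
  -- `v`; index sets containing `u` and `v` can thus omit a vertex of either side.
  obtain ⟨c, hc⟩ : ∃ c, (G.deleteEdges {s(u, v)}).Adj u c :=
    SimpleGraph.exists_adj_deleteEdges huv fun h =>
      hpend ⟨huv, u, Sym2.mem_mk_left u v, by convert h⟩
  obtain ⟨d, hd⟩ : ∃ d, (G.deleteEdges {s(u, v)}).Adj v d := by
    rw [Sym2.eq_swap]
    exact SimpleGraph.exists_adj_deleteEdges huv.symm fun h =>
      hpend ⟨huv, v, Sym2.mem_mk_right u v, by convert h⟩
  have hcover : ∀ a, (G.deleteEdges {s(u, v)}).Reachable u a ∨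
      (G.deleteEdges {s(u, v)}).Reachable v a :=
    fun a => SimpleGraph.reachable_deleteEdges_or v (hG.1.preconnected u a)
  have hadj : ∀ a b, G.Adj a b → (G.deleteEdges {s(u, v)}).Adj a b ∨
      (a = u ∧ b = v ∨ a = v ∧ b = u) := by
    intro a b hab
    rw [SimpleGraph.deleteEdges_adj, Set.mem_singleton_iff, Sym2.eq_iff]
    tauto
  have hle : G.deleteEdges {s(u, v)} ≤ G := SimpleGraph.deleteEdges_le _
  have hside : ((G.deleteEdges {s(u, v)}).induce
      {a | (G.deleteEdges {s(u, v)}).Reachable u a}).IsAcyclic ∨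
      ((G.deleteEdges {s(u, v)}).induce
        {a | (G.deleteEdges {s(u, v)}).Reachable u a}ᶜ).IsAcyclic := by
    refine (hG.isAcyclic_induce_or _).imp (fun h => h.anti ?_) fun h => h.anti ?_
    · exact fun a b hab => hle hab
    · exact fun a b hab => hle hab
  generalize G.deleteEdges {s(u, v)} = H at *
  have hp : ∀ a b, H.Adj a b → (H.Reachable u a ↔ H.Reachable u b) := fun a b hab =>
    ⟨fun h => h.trans hab.reachable, fun h => h.trans hab.symm.reachable⟩
  have hcu : H.Reachable u c := hc.reachable
  have hdu : ¬ H.Reachable u d := fun h => hb (h.trans hd.symm.reachable)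
  have hcd : c ≠ d := fun h => hdu (h ▸ hcu)
  have hcv : c ≠ v := fun h => hb (h ▸ hcu)
  have hdu' : d ≠ u := fun h => hdu (h ▸ SimpleGraph.Reachable.refl d)
  have huc : u ≠ c := hc.ne
  have hvd : v ≠ d := hd.ne
  -- alternating functions vanish once they vanish at a vertex on either side
  have hvanish : ∀ x, H.IsSignAlternating x → ∀ a b, H.Reachable u a → ¬ H.Reachable u b →
      x a = 0 → x b = 0 → x = 0 := by
    intro x hx a b ha hb' hxa hxb
    have hvb := (hcover b).resolve_left hb'
    ext e
    rcases hcover e with he | he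
    · exact hx.eq_zero_of_reachable (ha.symm.trans he) hxa
    · exact hx.eq_zero_of_reachable (hvb.symm.trans he) hxb
  have hbip : ∀ x y, H.IsSignAlternating x → H.IsSignAlternating y → x u ≠ 0 → y v ≠ 0 →
      G.IsBipartite := by
    intro x y hx hy hxu hyv
    rw [SimpleGraph.isBipartite_iff_exists_isSignAlternating]
    -- The normalisation gives the values 1 at `u` and -1 at `v`, so the glued function also
    -- alternates along `uv`.
    refine ⟨fun a => if H.Reachable u a then x a / x u else -(y a / y v), ?_, ?_⟩
    · intro a b hab
      rcases hadj a b hab with h | ⟨rfl, rfl⟩ | ⟨rfl, rfl⟩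
      · by_cases ha : H.Reachable u a
        · simp only [ha, (hp a b h).1 ha, if_true, hx a b h, neg_div]
        · simp only [ha, mt (hp a b h).2 ha, if_false, hy a b h, neg_div]
      · simp [hb, hxu, hyv]
      · simp [hb, hxu, hyv]
    · intro a
      by_cases ha : H.Reachable u a
      · simp only [ha, if_true]
        exact div_ne_zero (fun h => hxu (hx.eq_zero_of_reachable ha.symm h)) hxu
      · simp only [ha, if_false]
        exact neg_ne_zero.2 (div_ne_zero (fun h => hyv (hy.eq_zero_of_reachable
          ((hcover a).resolve_left ha).symm h)) hyv)
  have hsome : ∃ x, x ≠ 0 ∧ H.IsSignAlternating x := by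
    rcases hside with h | h
    · obtain ⟨x, hx, h0⟩ := SimpleGraph.IsSignAlternating.exists_of_isAcyclic_induce hp h
      exact ⟨x, fun hx0 => h0 u (SimpleGraph.Reachable.refl u) (congrFun hx0 u), hx⟩
    · obtain ⟨x, hx, h0⟩ := SimpleGraph.IsSignAlternating.exists_of_isAcyclic_induce
        (fun a b hab => not_congr (hp a b hab)) h
      exact ⟨x, fun hx0 => h0 v hb (congrFun hx0 v), hx⟩
  have hzero : G.signlessLapCoeff i = (G.contractAttach u v).signlessLapCoeff i ↔
      ∀ s : Finset V, s.card = i → u ∈ s → v ∈ s →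
        ∃ x : V → ℝ, x ≠ 0 ∧ H.IsSignAlternating x ∧ ∀ c ∉ s, x c = 0 := by
    rw [← sub_eq_zero, hdiff, Finset.sum_eq_zero_iff_of_nonneg fun s _ => hnonneg s]
    simp only [hdet, Finset.mem_filter, Finset.mem_powersetCard, Finset.subset_univ, true_and,
      and_imp]
  have hmid : 2 ≤ i → i + 2 ≤ Fintype.card V →
      G.signlessLapCoeff i ≠ (G.contractAttach u v).signlessLapCoeff i := by
    intro h2 hn h
    -- An index set omitting both `c` and `d` forces an alternating function to vanish on both
    -- sides, so its minor is positive.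
    obtain ⟨s, hs, hs', hsi⟩ := Finset.exists_subsuperset_card_eq
      (s := {u, v}) (t := {c, d}ᶜ) (n := i) (by
        intro a ha
        simp only [Finset.mem_insert, Finset.mem_singleton, Finset.mem_compl] at ha ⊢
        rcases ha with rfl | rfl
        · rintro (h | h)
          · exact huc h
          · exact hdu' h.symm
        · rintro (h | h)
          · exact hcv h.symm
          · exact hvd h)
      (by rw [Finset.card_pair huv.ne]; exact h2)
      (by rw [Finset.card_compl, Finset.card_pair hcd]; omega)
    obtain ⟨x, hx0, hx, hxs⟩ := hzero.1 h s hsi (hs (by simp)) (hs (by simp))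
    refine hx0 (hvanish x hx c d hcu hdu (hxs c fun h => ?_) (hxs d fun h => ?_))
    · simpa using hs' h
    · simpa using hs' h
  have hsmall : i = 0 ∨ i = 1 →
      G.signlessLapCoeff i = (G.contractAttach u v).signlessLapCoeff i := by
    intro h
    refine hzero.2 fun s hs hus hvs => ?_
    have := Finset.one_lt_card.2 ⟨u, hus, v, hvs, huv.ne⟩
    omega
  have htop : i = Fintype.card V →
      G.signlessLapCoeff i = (G.contractAttach u v).signlessLapCoeff i := by
    intro h
    refine hzero.2 fun s hs _ _ => ?_
    obtain rfl := Finset.card_eq_iff_eq_univ s |>.1 (hs.trans h)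
    obtain ⟨x, hx0, hx⟩ := hsome
    exact ⟨x, hx0, hx, fun c hc => absurd (Finset.mem_univ c) hc⟩
  -- This keeps the truncated subtraction in `Fintype.card V - 1` honest.
  have hcard : 2 < Fintype.card V :=
    Finset.two_lt_card.2 ⟨u, Finset.mem_univ _, v, Finset.mem_univ _, c, Finset.mem_univ _,
      huv.ne, huc, hcv.symm⟩
  refine ⟨?_, fun hnb => ⟨fun h => ?_, ?_⟩, fun hbi => ⟨fun h => ?_, ?_⟩⟩
  · rw [← sub_nonneg, hdiff]
    exact Finset.sum_nonneg fun s _ => hnonneg s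
  · by_contra! hne
    have hi1 : i + 1 = Fintype.card V := by
      by_contra h'
      exact hmid (by omega) (by omega) h
    have hcompl : ∀ a : V, ({a}ᶜ : Finset V).card = i := fun a => by
      rw [Finset.card_compl, Finset.card_singleton]
      omega
    -- Omitting only `d` yields a function living on the side of `u`, omitting only `c` one on the
    -- side of `v`; together they would make `G` bipartite.
    obtain ⟨x, hx0, hx, hxs⟩ := hzero.1 h {d}ᶜ (hcompl d) (by simpa using hdu'.symm)
      (by simpa using hvd)
    obtain ⟨y, hy0, hy, hys⟩ := hzero.1 h {c}ᶜ (hcompl c) (by simpa using huc)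
      (by simpa using hcv.symm)
    refine hnb (hbip x y hx hy (fun hxu => hx0 ?_) fun hyv => hy0 ?_)
    · exact hvanish x hx u d (SimpleGraph.Reachable.refl u) hdu hxu (hxs d (by simp))
    · exact hvanish y hy c v hcu hb (hys c (by simp)) hyv
  · rintro (h | h | h)
    · exact hsmall (Or.inl h)
    · exact hsmall (Or.inr h)
    · exact htop h
  · by_contra! hne
    exact hmid (by omega) (by omega) h
  · rintro (h | h | h | h)
    · exact hsmall (Or.inl h)
    · exact hsmall (Or.inr h)
    · refine hzero.2 fun s hs hus hvs => ?_
      obtain ⟨x, hx, hx0⟩ := SimpleGraph.isBipartite_iff_exists_isSignAlternating.1 hbi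
      have hxH : H.IsSignAlternating x := fun a b hab => hx a b (hle hab)
      have hsc : sᶜ.card = 1 := by
        rw [Finset.card_compl]
        omega
      obtain ⟨e, he⟩ := Finset.card_eq_one.1 hsc
      have hes : ∀ a ∉ s, a = e := fun a ha => by
        rw [← Finset.mem_compl, he] at ha
        simpa using ha
      -- The required function is the 2-colouring of `G` restricted to the side which does not
      -- contain the single missing vertex `e`.
      by_cases hue : H.Reachable u e
      · refine ⟨_, fun h0 => ?_, hxH.restrict fun a b hab => not_congr (hp a b hab), ?_⟩
        · have := congrFun h0 v
          simp [hb, hx0] at this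
        · intro a ha
          simp [hes a ha, hue]
      · refine ⟨_, fun h0 => ?_, hxH.restrict hp, ?_⟩
        · have := congrFun h0 u
          simp [hx0] at this
        · intro a ha
          simp [hes a ha, hue]
    · exact htop h
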